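/- **Definitions.** A *partial commutative monoid* (PCM) is a set with an element $0$ and a partial binary operation $\ovee$ (write $a\perp b$ if $a\ovee b$ is defined) such that: $a\perp b$ implies $b\perp a$ and $a\ovee b=b\ovee a$; $a\perp b$ and $a\ovee b\perp c$ imply $b\perp c$, $a\perp b\ovee c$ and $(a\ovee b)\ovee c=a\ovee(b\ovee c)$; and $0\perp a$, $0\ovee a=a$. Write $a\le b$ if $a\ovee c=b$ for some $c$. An *effect algebra* is a PCM with an element $1$ such that every $a$ has a unique $a^\perp$ with $a\ovee a^\perp=1$, and $a\perp 1$ implies $a=0$. An *effectus in partial form* is a category $C$ with finite coproducts, in which every hom-set is a PCM, such that $f\perp g$ implies $h\circ f\perp h\circ g$, $f\circ k\perp g\circ k$, $h\circ(f\ovee g)=(h\circ f)\ovee(h\circ g)$ and $(f\ovee g)\circ k=(f\circ k)\ovee(g\circ k)$; such that $[\mathrm{id},0]\circ b\perp[0,\mathrm{id}]\circ b$ for every $b\colon X\to Y+Y$; such that $f\perp g$ implies $\kappa_1\circ f\perp\kappa_2\circ g$ for the coprojections $\kappa_1,\kappa_2\colon Y\to Y+Y$; and with a distinguished object $I$ such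 that each $\mathrm{Pred}\,X=C(X,I)$ (the *predicates* on $X$) is an effect algebra with top element $1$, $1\circ f\perp 1\circ g$ implies $f\perp g$, and $1\circ f=0$ implies $f=0$. Let $C$ be such an effectus. A *quotient* for $p\in\mathrm{Pred}\,X$ is a map $\xi\colon X\to Q$ with $1\circ\xi\le p^\perp$ such that every $f\colon X\to Y$ with $1\circ f\le p^\perp$ factors as $f=f'\circ\xi$ for a unique $f'$. A *comprehension* for $p$ is a map $\pi\colon K\to X$ with $p\circ\pi=1\circ\pi$ such that every $g\colon Z\to X$ with $p\circ g=1\circ g$ factors as $g=\pi\circ g'$ for a unique $g'$. A map is *pure* if it equals $\pi\circ\xi$ for a comprehension $\pi$ and a quotient $\xi$. The *image* $\mathrm{im}\,f$ of $f\colon X\to Y$ is the least predicate $p$ on $Y$ with $p\circ f=1\circ f$ (if it exists). A predicate is *sharp* if it is the image of some map. A map $f$ is *pristine* if it is pure and $1\circ f$ is sharp. $C$ is a *$\diamond$-effectus* if every predicate has a quotient and a comprehension, every map has an image, and $s^\perp$ is sharp for every sharp $s$. Then, writing $\pi_p$ for a comprehension for $p$, put $\lfloor p\rfloor=\mathrm{im}\,\pi_p$,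 $\lceil p\rceil=\lfloor p^\perp\rfloor^\perp$ and, for $f\colon X\to Y$ and sharp $s$, $f^\diamond(s)=\lceil s\circ f\rceil$ and $f_\diamond(s)=\mathrm{im}(f\circ\pi_s)$. Maps $f\colon X\to Y$ and $g\colon Y\to X$ are *$\diamond$-adjoint* if $f^\diamond=g_\diamond$ on sharp predicates; $g$ is *$\diamond$-self-adjoint* if it is $\diamond$-adjoint to itself; a pure endomap is *$\diamond$-positive* if it is $g\circ g$ for some $\diamond$-self-adjoint $g$. A $\diamond$-effectus is an *$\&$-effectus* if for every predicate $p$ on $X$ there is a unique $\diamond$-positive map $\mathrm{asrt}_p\colon X\to X$ with $1\circ\mathrm{asrt}_p=p$, and $\xi\circ\pi$ is pure for every comprehension $\pi\colon X\to Y$ and quotient $\xi\colon Y\to Z$. (Pure maps then form a subcategory.) A *$\dagger$-effectus* is an $\&$-effectus whose category of pure maps carries an involutive identity-on-objects contravariant functor $(\ )^\dagger$ such that $\mathrm{asrt}_p^\dagger=\mathrm{asrt}_p$ for every predicate $p$; every pure $f$ is $\diamond$-adjoint to $f^\dagger$; for every $\dagger$-positive $f$ (i.e. $f=g^\dagger\circ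 g$ with $g$ pure) there is a unique $\dagger$-positive $g$ with $g\circ g=f$; and every $\diamond$-positive map is $\dagger$-positive. A category is *pointed semiexact* if it has a zero object and every map has a kernel and a cokernel. In such a category, for every map $f$ there is a unique $g$ with $f=(\ker\operatorname{cok}f)\circ g\circ(\operatorname{cok}\ker f)$; $f$ is *exact* if this $g$ is an isomorphism. For kernels $n\colon A\to X$, $m\colon B\to X$ write $n\le m$ if $n=m\circ h$ for some $h$. A pointed semiexact category is a *pointed homological category* if kernels are closed under composition, cokernels are closed under composition, and (homology axiom) for every kernel $m\colon M\to A$ and cokernel $q\colon A\to Q$ with $\ker q\le m$, the composite $q\circ m$ is exact. **Theorem.** Every $\dagger$-effectus (in partial form) is a pointed homological category. Moreover, in it 1. a map is a kernel (of some map) if and only if it is a comprehension (for some predicate); 2. a map is a cokernel (of some map) if and only if it is a quotient for some sharp predicate; 3. a map is exact if and only if it is pristine. -/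

import Mathlib

open CategoryTheory CategoryTheory.Limits

universe v u w

noncomputable section

namespace EffectusTheory

/-! ### Partial commutative monoids and effect algebras -/

/-- A partial commutative monoid. The partial sum is given by its domain of definition `Orth`
and an operation `osum` of which only the values at pairs with `Orth a b` are meaningful. -/
class PCM (M : Type w) where
  /-- the neutral element -/
  zero : M
  /-- `Orth a b`: the partial sum of `a` and `b` is defined -/
  Orth : M → M → Prop
  /-- the partial sum -/
  osum : M → M → M
  orth_symm : ∀ {a b : M}, Orth a b → Orth b a
  osum_comm : ∀ {a b : M}, Orth a b → osum a b = osum b a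
  orth_of_orth_osum : ∀ {a b c : M}, Orth a b → Orth (osum a b) c → Orth b c
  orth_osum : ∀ {a b c : M}, Orth a b → Orth (osum a b) c → Orth a (osum b c)
  osum_assoc : ∀ {a b c : M}, Orth a b → Orth (osum a b) c →
    osum (osum a b) c = osum a (osum b c)
  zero_orth : ∀ a : M, Orth zero a
  zero_osum : ∀ a : M, osum zero a = a

/-- The preorder of a partial commutative monoid. -/
def PCM.Le {M : Type w} [PCM M] (a b : M) : Prop :=
  ∃ c : M, PCM.Orth a c ∧ PCM.osum a c = b

/-- The partial commutative monoid `E` together with the element `one` is an effect algebra. -/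
structure IsEffectAlgebra {E : Type w} [PCM E] (one : E) : Prop where
  existsUnique_compl : ∀ a : E, ∃! b : E, PCM.Orth a b ∧ PCM.osum a b = one
  eq_zero_of_orth_one : ∀ a : E, PCM.Orth a one → a = PCM.zero

/-- In an effect algebra, an element that is its own double is zero. -/
theorem IsEffectAlgebra.eq_zero_of_osum_self {E : Type w} [PCM E] {one : E}
    (h : IsEffectAlgebra one) {a : E} (ha : PCM.Orth a a) (haa : PCM.osum a a = a) :
    a = PCM.zero := by
  obtain ⟨b, ⟨hab, hb⟩, -⟩ := h.existsUnique_compl a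
  have h1 : PCM.Orth (PCM.osum a a) b := by rw [haa]; exact hab
  have h2 := PCM.orth_osum ha h1
  rw [hb] at h2
  exact h.eq_zero_of_orth_one a h2

/-! ### Effectuses in partial form -/

/-- A category enriched in partial commutative monoids. -/
class PCMEnriched (C : Type u) [Category.{v} C] where
  homPCM : ∀ X Y : C, PCM (X ⟶ Y)
  orth_comp : ∀ {X Y Y' : C} {f g : X ⟶ Y} (h : Y ⟶ Y'),
    PCM.Orth f g → PCM.Orth (f ≫ h) (g ≫ h)
  osum_comp : ∀ {X Y Y' : C} {f g : X ⟶ Y} (h : Y ⟶ Y'),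
    PCM.Orth f g → PCM.osum f g ≫ h = PCM.osum (f ≫ h) (g ≫ h)
  comp_orth : ∀ {X' X Y : C} {f g : X ⟶ Y} (k : X' ⟶ X),
    PCM.Orth f g → PCM.Orth (k ≫ f) (k ≫ g)
  comp_osum : ∀ {X' X Y : C} {f g : X ⟶ Y} (k : X' ⟶ X),
    PCM.Orth f g → k ≫ PCM.osum f g = PCM.osum (k ≫ f) (k ≫ g)

attribute [reducible, instance] PCMEnriched.homPCM

/-- The first partial projector `[id, 0] : Y + Y ⟶ Y`. -/
def pproj₁ {C : Type u} [Category.{v} C] [HasFiniteCoproducts C] [PCMEnriched C] (Y : C) :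
    Y ⨿ Y ⟶ Y :=
  coprod.desc (𝟙 Y) PCM.zero

/-- The second partial projector `[0, id] : Y + Y ⟶ Y`. -/
def pproj₂ {C : Type u} [Category.{v} C] [HasFiniteCoproducts C] [PCMEnriched C] (Y : C) :
    Y ⨿ Y ⟶ Y :=
  coprod.desc PCM.zero (𝟙 Y)

/-- A finitely partially additive category. -/
class FinPAC (C : Type u) [Category.{v} C] [HasFiniteCoproducts C] extends PCMEnriched C where
  /-- compatible sum axiom -/
  compatible_sum : ∀ {X Y : C} (b : X ⟶ Y ⨿ Y), PCM.Orth (b ≫ pproj₁ Y) (b ≫ pproj₂ Y)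
  /-- untying axiom -/
  untying : ∀ {X Y : C} {f g : X ⟶ Y}, PCM.Orth f g →
    PCM.Orth (f ≫ (coprod.inl : Y ⟶ Y ⨿ Y)) (g ≫ (coprod.inr : Y ⟶ Y ⨿ Y))

/-- An effectus in partial form. -/
class Effectus (C : Type u) [Category.{v} C] [HasFiniteCoproducts C] extends FinPAC C where
  /-- the distinguished object -/
  I : C
  /-- the top predicate on each object -/
  truth : ∀ X : C, X ⟶ I
  isEffectAlgebra : ∀ X : C, IsEffectAlgebra (truth X)
  orth_of_orth_truth : ∀ {X Y : C} {f g : X ⟶ Y},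
    PCM.Orth (f ≫ truth Y) (g ≫ truth Y) → PCM.Orth f g
  eq_zero_of_comp_truth : ∀ {X Y : C} {f : X ⟶ Y},
    f ≫ truth Y = PCM.zero → f = PCM.zero

section Effectus

variable {C : Type u} [Category.{v} C] [HasFiniteCoproducts C] [Effectus C]

/-- A predicate on `X`. -/
abbrev Pred (X : C) : Type v := X ⟶ (Effectus.I : C)

/-- The top predicate `1` on `X`. -/
abbrev truth (X : C) : Pred X := Effectus.truth X

/-- The orthocomplement of a predicate. -/
def compl {X : C} (p : Pred X) : Pred X :=
  ((Effectus.isEffectAlgebra X).existsUnique_compl p).choose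

theorem pred_zero_of_idem {X : C} {p : Pred X} (hp : PCM.Orth p p) (h : PCM.osum p p = p) :
    p = PCM.zero :=
  (Effectus.isEffectAlgebra X).eq_zero_of_osum_self hp h

theorem comp_zero_aux {X Y Z : C} (f : X ⟶ Y) :
    f ≫ (PCM.zero : Y ⟶ Z) = PCM.zero := by
  have hz : PCM.Orth (PCM.zero : Y ⟶ Z) PCM.zero := PCM.zero_orth _
  apply Effectus.eq_zero_of_comp_truth
  have h1 := PCMEnriched.orth_comp (Effectus.truth Z) (PCMEnriched.comp_orth f hz)
  apply pred_zero_of_idem h1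
  rw [← PCMEnriched.osum_comp _ (PCMEnriched.comp_orth f hz), ← PCMEnriched.comp_osum f hz,
    PCM.zero_osum]

theorem zero_comp_aux {X Y Z : C} (g : Y ⟶ Z) :
    (PCM.zero : X ⟶ Y) ≫ g = PCM.zero := by
  have hz : PCM.Orth (PCM.zero : X ⟶ Y) PCM.zero := PCM.zero_orth _
  apply Effectus.eq_zero_of_comp_truth
  have h1 := PCMEnriched.orth_comp (Effectus.truth Z) (PCMEnriched.orth_comp g hz)
  apply pred_zero_of_idem h1
  rw [← PCMEnriched.osum_comp _ (PCMEnriched.orth_comp g hz), ← PCMEnriched.osum_comp g hz,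
    PCM.zero_osum]

/-- The zeros of the hom-PCMs are zero morphisms. -/
instance : HasZeroMorphisms C where
  zero _ _ := ⟨PCM.zero⟩
  comp_zero f _ := comp_zero_aux f
  zero_comp _ _ _ g := zero_comp_aux g

/-- `ξ` is a quotient for the predicate `p`. -/
def IsQuotient {X Q : C} (p : Pred X) (ξ : X ⟶ Q) : Prop :=
  PCM.Le (ξ ≫ truth Q) (compl p) ∧
    ∀ ⦃Y : C⦄ (f : X ⟶ Y), PCM.Le (f ≫ truth Y) (compl p) → ∃! f' : Q ⟶ Y, ξ ≫ f' = f

/-- `π` is a comprehension for the predicate `p`. -/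
def IsComprehension {K X : C} (p : Pred X) (π : K ⟶ X) : Prop :=
  π ≫ p = π ≫ truth X ∧
    ∀ ⦃Z : C⦄ (g : Z ⟶ X), g ≫ p = g ≫ truth X → ∃! g' : Z ⟶ K, g' ≫ π = g

/-- A pure map is a quotient followed by a comprehension. -/
def IsPure {X Y : C} (f : X ⟶ Y) : Prop :=
  ∃ (Z : C) (ξ : X ⟶ Z) (π : Z ⟶ Y),
    (∃ p : Pred X, IsQuotient p ξ) ∧ (∃ q : Pred Y, IsComprehension q π) ∧ f = ξ ≫ π

/-- `p` is the image of `f`: the least predicate `q` with `q ∘ f = 1 ∘ f`. -/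
def IsImage {X Y : C} (f : X ⟶ Y) (p : Pred Y) : Prop :=
  f ≫ p = f ≫ truth Y ∧ ∀ q : Pred Y, f ≫ q = f ≫ truth Y → PCM.Le p q

/-- A predicate is sharp if it is the image of some map. -/
def IsSharp {Y : C} (p : Pred Y) : Prop :=
  ∃ (X : C) (f : X ⟶ Y), IsImage f p

/-- A pristine map is a pure map `f` such that `1 ∘ f` is sharp. -/
def IsPristine {X Y : C} (f : X ⟶ Y) : Prop :=
  IsPure f ∧ IsSharp (f ≫ truth Y)

end Effectus

/-! ### Diamond effectuses -/

/-- A `◇`-effectus: an effectus with quotients, comprehension and images, in which the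
orthocomplement of a sharp predicate is sharp. -/
class DiamondEffectus (C : Type u) [Category.{v} C] [HasFiniteCoproducts C] [Effectus C] :
    Prop where
  exists_quotient : ∀ {X : C} (p : Pred X), ∃ (Q : C) (ξ : X ⟶ Q), IsQuotient p ξ
  exists_comprehension : ∀ {X : C} (p : Pred X), ∃ (K : C) (π : K ⟶ X), IsComprehension p π
  exists_image : ∀ {X Y : C} (f : X ⟶ Y), ∃ p : Pred Y, IsImage f p
  isSharp_compl : ∀ {X : C} (s : Pred X), IsSharp s → IsSharp (compl s)

section Diamond

variable {C : Type u} [Category.{v} C] [HasFiniteCoproducts C] [Effectus C] [DiamondEffectus C]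

/-- The domain of a chosen comprehension for `p`. -/
def comprObj {X : C} (p : Pred X) : C :=
  (DiamondEffectus.exists_comprehension p).choose

/-- A chosen comprehension for `p`. -/
def compr {X : C} (p : Pred X) : comprObj p ⟶ X :=
  (DiamondEffectus.exists_comprehension p).choose_spec.choose

/-- The image of a map. -/
def im {X Y : C} (f : X ⟶ Y) : Pred Y :=
  (DiamondEffectus.exists_image f).choose

/-- The floor of a predicate: the image of a comprehension for it. -/
def floor {X : C} (p : Pred X) : Pred X := im (compr p)

/-- The ceiling of a predicate. -/
def ceil {X : C} (p : Pred X) : Pred X := compl (floor (compl p))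

/-- `f^◇ (s) = ⌈s ∘ f⌉`. -/
def diamondUp {X Y : C} (f : X ⟶ Y) (s : Pred Y) : Pred X := ceil (f ≫ s)

/-- `f_◇ (s) = im (f ∘ π_s)`. -/
def diamondDown {X Y : C} (f : X ⟶ Y) (s : Pred X) : Pred Y := im (compr s ≫ f)

/-- `f` and `g` are `◇`-adjoint: `f^◇ = g_◇` as maps on sharp predicates. -/
def DiamondAdjoint {X Y : C} (f : X ⟶ Y) (g : Y ⟶ X) : Prop :=
  ∀ s : Pred Y, IsSharp s → diamondUp f s = diamondDown g s

/-- A pure endomap is `◇`-positive if it is the square of a `◇`-self-adjoint map. -/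
def DiamondPositive {X : C} (f : X ⟶ X) : Prop :=
  IsPure f ∧ ∃ g : X ⟶ X, DiamondAdjoint g g ∧ f = g ≫ g

end Diamond

/-! ### `&`-effectuses and dagger effectuses -/

/-- An `&`-effectus. -/
class AndthenEffectus (C : Type u) [Category.{v} C] [HasFiniteCoproducts C] [Effectus C] : Prop
    extends DiamondEffectus C where
  existsUnique_asrt : ∀ {X : C} (p : Pred X),
    ∃! a : X ⟶ X, DiamondPositive a ∧ a ≫ truth X = p
  isPure_comprehension_comp_quotient : ∀ {X Y Z : C} (π : X ⟶ Y) (ξ : Y ⟶ Z),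
    (∃ p : Pred Y, IsComprehension p π) → (∃ q : Pred Y, IsQuotient q ξ) → IsPure (π ≫ ξ)

section Andthen

variable {C : Type u} [Category.{v} C] [HasFiniteCoproducts C] [Effectus C] [AndthenEffectus C]

/-- The assert map of a predicate. -/
def asrt {X : C} (p : Pred X) : X ⟶ X :=
  (AndthenEffectus.existsUnique_asrt p).choose

theorem asrt_diamondPositive {X : C} (p : Pred X) : DiamondPositive (asrt p) :=
  (AndthenEffectus.existsUnique_asrt p).choose_spec.1.1

end Andthen

/-- A pure map from `X` to `Y`. -/
abbrev PureHom {C : Type u} [Category.{v} C] [HasFiniteCoproducts C] [Effectus C] (X Y : C) :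
    Type v :=
  {f : X ⟶ Y // IsPure f}

/-- An endomap is `†`-positive, for an operation `dag` on pure maps, if it is of the form
`g† ∘ g` for a pure map `g`. -/
def DaggerPositive {C : Type u} [Category.{v} C] [HasFiniteCoproducts C] [Effectus C]
    (dag : ∀ {X Y : C}, PureHom X Y → PureHom Y X) {X : C} (f : X ⟶ X) : Prop :=
  ∃ (Y : C) (g : PureHom X Y), f = g.1 ≫ (dag g).1

/-- A `†`-effectus: an `&`-effectus whose pure maps carry a compatible dagger. (Identities and
composites of pure maps are pure in any `&`-effectus, so the hypotheses `IsPure _` in `dag_id`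
and `dag_comp` are no restriction.) -/
class DaggerEffectus (C : Type u) [Category.{v} C] [HasFiniteCoproducts C] [Effectus C]
    extends AndthenEffectus C where
  dag : ∀ {X Y : C}, PureHom X Y → PureHom Y X
  dag_id : ∀ (X : C) (h : IsPure (𝟙 X)), (dag ⟨𝟙 X, h⟩).1 = 𝟙 X
  dag_comp : ∀ {X Y Z : C} (f : PureHom X Y) (g : PureHom Y Z) (h : IsPure (f.1 ≫ g.1)),
    (dag ⟨f.1 ≫ g.1, h⟩).1 = (dag g).1 ≫ (dag f).1
  dag_dag : ∀ {X Y : C} (f : PureHom X Y), dag (dag f) = f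
  dag_asrt : ∀ {X : C} (p : Pred X),
    (dag ⟨asrt p, (asrt_diamondPositive p).1⟩).1 = asrt p
  diamondAdjoint_dag : ∀ {X Y : C} (f : PureHom X Y), DiamondAdjoint f.1 (dag f).1
  existsUnique_sqrt : ∀ {X : C} (f : X ⟶ X), DaggerPositive dag f →
    ∃! g : X ⟶ X, DaggerPositive dag g ∧ g ≫ g = f
  daggerPositive_of_diamondPositive : ∀ {X : C} (f : X ⟶ X),
    DiamondPositive f → DaggerPositive dag f

/-! ### Homological categories -/

/-- A pointed semiexact category: it has a zero object and all kernels and cokernels. -/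
class PointedSemiexact (C : Type u) [Category.{v} C] [HasZeroMorphisms C] : Prop where
  hasZeroObject : HasZeroObject C
  hasKernels : HasKernels C
  hasCokernels : HasCokernels C

attribute [instance] PointedSemiexact.hasKernels PointedSemiexact.hasCokernels

/-- `m` is a kernel (of some map). -/
def IsKernelMap {C : Type u} [Category.{v} C] [HasZeroMorphisms C] {X Y : C} (m : X ⟶ Y) :
    Prop :=
  Nonempty (NormalMono m)

/-- `q` is a cokernel (of some map). -/
def IsCokernelMap {C : Type u} [Category.{v} C] [HasZeroMorphisms C] {X Y : C} (q : X ⟶ Y) :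
    Prop :=
  Nonempty (NormalEpi q)

/-- A map `f` is exact if the unique `g` with `f = ker (cok f) ∘ g ∘ cok (ker f)` is an
isomorphism. -/
def IsExactMap {C : Type u} [Category.{v} C] [HasZeroMorphisms C] [PointedSemiexact C]
    {X Y : C} (f : X ⟶ Y) : Prop :=
  IsIso (Abelian.coimageImageComparison f)

/-- A pointed homological category. -/
class PointedHomological (C : Type u) [Category.{v} C] [HasZeroMorphisms C] : Prop
    extends PointedSemiexact C where
  isKernelMap_comp : ∀ {X Y Z : C} (m : X ⟶ Y) (n : Y ⟶ Z),
    IsKernelMap m → IsKernelMap n → IsKernelMap (m ≫ n)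
  isCokernelMap_comp : ∀ {X Y Z : C} (p : X ⟶ Y) (q : Y ⟶ Z),
    IsCokernelMap p → IsCokernelMap q → IsCokernelMap (p ≫ q)
  /-- homology axiom; the last hypothesis says `ker q ≤ m` -/
  homology : ∀ {M A Q : C} (m : M ⟶ A) (q : A ⟶ Q), IsKernelMap m → IsCokernelMap q →
    (∃ f : kernel q ⟶ M, f ≫ m = kernel.ι q) → IsExactMap (m ≫ q)

end EffectusTheory

end

open EffectusTheory

open EffectusTheory

namespace EffectusTheory

/-! ### Effect algebra order and predicates. -/

section Predicates

variable {C : Type u} [Category.{v} C] [HasFiniteCoproducts C] [Effectus C]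
variable {X Y Z : C}

/-! A map `k` satisfies `g ∘ k = 0` exactly when `(1 ∘ g)^⊥ ∘ k = 1 ∘ k`, so a kernel of `g` has the
same universal property as a comprehension for `(1 ∘ g)^⊥`. Dually, `k ∘ f = 0` exactly when `1 ∘ k
≤ (im f)^⊥`, so a cokernel of `f` is a quotient for `im f`. Hence kernels are the comprehensions and
cokernels the quotients for sharp predicates. In the canonical factorisation of `f`, the outer maps
are a quotient for `⌊(1 ∘ f)^⊥⌋` and a comprehension for `im f`. These agree up to isomorphism with
a pure factorisation once `1 ∘ f` is sharp, so exact means pristine.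

The remaining axioms rest on a splitting: for sharp `s`, a comprehension `π` for `s` and a quotient
`ξ` for `s^⊥` can be matched so that `ξ ∘ π = id` and `π ∘ ξ = asrt_s` (`IsQuotient.exists_section`,
`IsComprehension.exists_retraction`). It comes from factoring the pure map `asrt_s`, which is
idempotent because assert maps are unique. Retractions and sections transport predicates and give
closure under composition; `◇`-self-adjointness of `asrt_s` shows that the predicates obtained stay
sharp. In the homology axiom the composite is pure by the `&`-effectus axiom, so only sharpness of
its domain predicate is left. -/

theorem orth_zero {M : Type w} [PCM M] (a : M) : PCM.Orth a PCM.zero :=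
  PCM.orth_symm (PCM.zero_orth a)

theorem osum_zero {M : Type w} [PCM M] (a : M) : PCM.osum a PCM.zero = a := by
  rw [PCM.osum_comm (orth_zero a), PCM.zero_osum]

theorem PCM.Le.refl {M : Type w} [PCM M] (a : M) : PCM.Le a a :=
  ⟨PCM.zero, orth_zero a, osum_zero a⟩

theorem PCM.Le.trans {M : Type w} [PCM M] {a b c : M} (hab : PCM.Le a b) (hbc : PCM.Le b c) :
    PCM.Le a c := by
  obtain ⟨d, hd, rfl⟩ := hab
  obtain ⟨e, he, rfl⟩ := hbc
  exact ⟨PCM.osum d e, PCM.orth_osum hd he, (PCM.osum_assoc hd he).symm⟩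

theorem orth_compl (p : Pred X) : PCM.Orth p (compl p) :=
  ((Effectus.isEffectAlgebra X).existsUnique_compl p).choose_spec.1.1

theorem osum_compl (p : Pred X) : PCM.osum p (compl p) = truth X :=
  ((Effectus.isEffectAlgebra X).existsUnique_compl p).choose_spec.1.2

theorem eq_compl {p q : Pred X} (h : PCM.Orth p q) (h' : PCM.osum p q = truth X) :
    q = compl p :=
  ((Effectus.isEffectAlgebra X).existsUnique_compl p).choose_spec.2 q ⟨h, h'⟩

theorem compl_compl (p : Pred X) : compl (compl p) = p :=
  (eq_compl (PCM.orth_symm (orth_compl p))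
    (by rw [← PCM.osum_comm (orth_compl p), osum_compl])).symm

theorem compl_truth : compl (truth X) = 0 :=
  (eq_compl (orth_zero _) (osum_zero _)).symm

theorem compl_zero : compl (0 : Pred X) = truth X := by
  rw [← compl_truth, compl_compl]

/-- Both summands are forced to be the orthocomplement of `p ⊕ (p ⊕ q)^⊥`, and orthocomplements are
unique. -/
theorem osum_left_cancel {p q r : Pred X} (hq : PCM.Orth p q) (hr : PCM.Orth p r)
    (h : PCM.osum p q = PCM.osum p r) : q = r := by
  have key : ∀ {a : Pred X}, PCM.Orth p a → PCM.osum p a = PCM.osum p q →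
      a = compl (PCM.osum p (compl (PCM.osum p q))) := by
    intro a ha hs
    have ha' := PCM.orth_symm ha
    have hs' : PCM.osum a p = PCM.osum p q := by rw [← hs, PCM.osum_comm ha]
    have h1 : PCM.Orth (PCM.osum a p) (compl (PCM.osum p q)) := by
      rw [hs']; exact orth_compl _
    have h2 := PCM.orth_osum ha' h1
    refine eq_compl (PCM.orth_symm h2) ?_
    rw [← PCM.osum_comm h2, ← PCM.osum_assoc ha' h1, hs', osum_compl]
  rw [key hq rfl, ← key hr h.symm]

theorem PCM.Le.antisymm {p q : Pred X} (hpq : PCM.Le p q) (hqp : PCM.Le q p) : p = q := by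
  obtain ⟨c, hc, rfl⟩ := hpq
  obtain ⟨d, hd, h⟩ := hqp
  have h1 := PCM.orth_osum hc hd
  rw [PCM.osum_assoc hc hd] at h
  have h2 : PCM.osum c d = PCM.zero :=
    osum_left_cancel h1 (orth_zero p) (by rw [h, osum_zero])
  have hcd := PCM.orth_of_orth_osum hc hd
  -- Positivity: since `d ⊕ c = 0` is orthogonal to `1`, so is `c`, which forces `c = 0`.
  have hc0 : c = PCM.zero := by
    refine (Effectus.isEffectAlgebra X).eq_zero_of_orth_one c ?_
    refine PCM.orth_of_orth_osum (PCM.orth_symm hcd) ?_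
    rw [← PCM.osum_comm hcd, h2]
    exact PCM.zero_orth _
  rw [hc0, osum_zero]

theorem le_truth (p : Pred X) : PCM.Le p (truth X) := ⟨compl p, orth_compl p, osum_compl p⟩

theorem zero_le (p : Pred X) : PCM.Le 0 p := ⟨p, PCM.zero_orth p, PCM.zero_osum p⟩

theorem eq_zero_of_le_zero {p : Pred X} (h : PCM.Le p 0) : p = 0 := h.antisymm (zero_le p)

theorem eq_truth_of_truth_le {p : Pred X} (h : PCM.Le (truth X) p) : p = truth X :=
  (le_truth p).antisymm h

theorem compl_le_compl {p q : Pred X} (h : PCM.Le p q) : PCM.Le (compl q) (compl p) := by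
  obtain ⟨c, hc, rfl⟩ := h
  have h1 := orth_compl (PCM.osum p c)
  have h2 := PCM.orth_of_orth_osum hc h1
  refine ⟨c, PCM.orth_symm h2, ?_⟩
  rw [← PCM.osum_comm h2]
  exact eq_compl (PCM.orth_osum hc h1) (by rw [← PCM.osum_assoc hc h1, osum_compl])

theorem le_compl_comm {p q : Pred X} : PCM.Le p (compl q) ↔ PCM.Le q (compl p) :=
  ⟨fun h => by simpa only [compl_compl] using compl_le_compl h,
    fun h => by simpa only [compl_compl] using compl_le_compl h⟩

theorem comp_le (f : X ⟶ Y) {p q : Pred Y} (h : PCM.Le p q) : PCM.Le (f ≫ p) (f ≫ q) := by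
  obtain ⟨c, hc, rfl⟩ := h
  exact ⟨f ≫ c, PCMEnriched.comp_orth f hc, (PCMEnriched.comp_osum f hc).symm⟩

theorem comp_le_truth (f : X ⟶ Y) (g : Y ⟶ Z) :
    PCM.Le ((f ≫ g) ≫ truth Z) (f ≫ truth Y) := by
  rw [Category.assoc]
  exact comp_le f (le_truth _)

theorem comp_eq_truth_iff (f : X ⟶ Y) (p : Pred Y) :
    f ≫ p = f ≫ truth Y ↔ f ≫ compl p = 0 := by
  have h1 := PCMEnriched.comp_orth f (orth_compl p)
  have h2 : PCM.osum (f ≫ p) (f ≫ compl p) = f ≫ truth Y := by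
    rw [← PCMEnriched.comp_osum f (orth_compl p), osum_compl]
  constructor
  · intro h
    exact osum_left_cancel h1 (orth_zero _) (h2.trans (h.symm.trans (osum_zero _).symm))
  · intro h
    rw [← h2, h]
    exact (osum_zero _).symm

theorem comp_compl_of_total {f : X ⟶ Y} (hf : f ≫ truth Y = truth X) (p : Pred Y) :
    f ≫ compl p = compl (f ≫ p) :=
  eq_compl (PCMEnriched.comp_orth f (orth_compl p))
    (by rw [← PCMEnriched.comp_osum f (orth_compl p), osum_compl, hf])

theorem comp_truth_eq_zero_iff {f : X ⟶ Y} : f ≫ truth Y = 0 ↔ f = 0 :=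
  ⟨Effectus.eq_zero_of_comp_truth, fun h => by rw [h, zero_comp]⟩

/-- The complement `c` of the identity has `1 ∘ c` orthogonal to `1`, hence `1 ∘ c = 0` and `c = 0`.
Consequently a predicate, viewed as a map into `I`, has itself as domain predicate. -/
theorem truth_I : truth (Effectus.I : C) = 𝟙 (Effectus.I : C) := by
  set c : Pred (Effectus.I : C) := compl (𝟙 (Effectus.I : C))
  have h : PCM.Orth (𝟙 (Effectus.I : C)) c := orth_compl (𝟙 _)
  have h1 := PCMEnriched.orth_comp (truth (Effectus.I : C)) h
  rw [Category.id_comp] at h1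
  have hc : c = PCM.zero := Effectus.eq_zero_of_comp_truth
    ((Effectus.isEffectAlgebra _).eq_zero_of_orth_one _ (PCM.orth_symm h1))
  have h2 : PCM.osum (𝟙 (Effectus.I : C)) c = truth _ := osum_compl _
  rw [hc, osum_zero] at h2
  exact h2.symm

theorem pred_comp_truth (p : Pred X) : p ≫ truth (Effectus.I : C) = p := by
  rw [truth_I, Category.comp_id]

end Predicates

/-! ### Universal properties of quotients, comprehensions and images. -/

section QuotientsComprehensions

variable {C : Type u} [Category.{v} C] [HasFiniteCoproducts C] [Effectus C]
variable {X Y Z K Q : C}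

/-- The predicate `p^⊥` is itself a map to which the universal property applies, so it factors
through `ξ` and lies below `1 ∘ ξ`. -/
theorem IsQuotient.comp_truth {p : Pred X} {ξ : X ⟶ Q} (h : IsQuotient p ξ) :
    ξ ≫ truth Q = compl p := by
  refine h.1.antisymm ?_
  obtain ⟨r, hr, -⟩ := h.2 (compl p) (by rw [pred_comp_truth]; exact PCM.Le.refl _)
  have := comp_le ξ (le_truth r)
  rwa [hr] at this

theorem IsQuotient.epi {p : Pred X} {ξ : X ⟶ Q} (h : IsQuotient p ξ) : Epi ξ := by
  refine ⟨fun {W} a b hab => ?_⟩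
  exact (h.2 (ξ ≫ b) ((comp_le_truth ξ b).trans h.1)).unique hab rfl

theorem IsComprehension.mono {p : Pred X} {π : K ⟶ X} (h : IsComprehension p π) : Mono π := by
  refine ⟨fun {W} a b hab => ?_⟩
  exact (h.2 (b ≫ π) (by rw [Category.assoc, h.1, Category.assoc])).unique hab rfl

theorem IsQuotient.isIso_of_total {p : Pred X} {ξ : X ⟶ Q} (h : IsQuotient p ξ)
    (ht : ξ ≫ truth Q = truth X) : IsIso ξ := by
  have := h.epi
  obtain ⟨g, hg, -⟩ := h.2 (𝟙 X)
    (by rw [Category.id_comp, ← h.comp_truth, ht]; exact PCM.Le.refl _)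
  exact ⟨g, hg, by rw [← cancel_epi ξ, reassoc_of% hg, Category.comp_id]⟩

theorem IsQuotient.comp_isIso {p : Pred X} {ξ : X ⟶ Q} (h : IsQuotient p ξ) (e : Q ⟶ Y)
    [IsIso e] : IsQuotient p (ξ ≫ e) := by
  refine ⟨(comp_le_truth ξ e).trans h.1, fun W f hf => ?_⟩
  have := h.epi
  obtain ⟨g, hg, -⟩ := h.2 f hf
  refine ⟨inv e ≫ g, by simpa using hg, fun k hk => ?_⟩
  rw [← cancel_epi (ξ ≫ e), hk]
  simp [hg]

theorem IsComprehension.isIso_comp {p : Pred X} {π : K ⟶ X} (h : IsComprehension p π)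
    (e : Y ⟶ K) [IsIso e] : IsComprehension p (e ≫ π) := by
  refine ⟨by rw [Category.assoc, h.1, Category.assoc], fun W f hf => ?_⟩
  have := h.mono
  obtain ⟨g, hg, -⟩ := h.2 f hf
  refine ⟨g ≫ inv e, by simpa using hg, fun k hk => ?_⟩
  rw [← cancel_mono (e ≫ π), hk]
  simp [hg]

theorem IsQuotient.exists_iso {p : Pred X} {ξ : X ⟶ Q} {ξ' : X ⟶ Z} (h : IsQuotient p ξ)
    (h' : IsQuotient p ξ') : ∃ e : Q ⟶ Z, IsIso e ∧ ξ ≫ e = ξ' := by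
  have := h.epi
  have := h'.epi
  obtain ⟨e, he, -⟩ := h.2 ξ' h'.1
  obtain ⟨k, hk, -⟩ := h'.2 ξ h.1
  refine ⟨e, ⟨k, ?_, ?_⟩, he⟩
  · rw [← cancel_epi ξ, reassoc_of% he, hk, Category.comp_id]
  · rw [← cancel_epi ξ', reassoc_of% hk, he, Category.comp_id]

theorem IsComprehension.exists_iso {p : Pred X} {π : K ⟶ X} {π' : Z ⟶ X}
    (h : IsComprehension p π) (h' : IsComprehension p π') :
    ∃ e : Z ⟶ K, IsIso e ∧ e ≫ π = π' := by
  have := h.mono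
  have := h'.mono
  obtain ⟨e, he, -⟩ := h.2 π' h'.1
  obtain ⟨k, hk, -⟩ := h'.2 π h.1
  refine ⟨e, ⟨k, ?_, ?_⟩, he⟩
  · rw [← cancel_mono π', Category.assoc, hk, he, Category.id_comp]
  · rw [← cancel_mono π, Category.assoc, he, hk, Category.id_comp]

theorem isComprehension_id : IsComprehension (truth X) (𝟙 X) := by
  refine ⟨rfl, fun W f _ => ⟨f, Category.comp_id f, ?_⟩⟩
  intro k hk
  rwa [Category.comp_id] at hk

theorem isPure_of_eq {Z : C} {p : Pred X} {q : Pred Y} {ξ : X ⟶ Z} {π : Z ⟶ Y}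
    (hξ : IsQuotient p ξ) (hπ : IsComprehension q π) : IsPure (ξ ≫ π) :=
  ⟨Z, ξ, π, ⟨p, hξ⟩, ⟨q, hπ⟩, rfl⟩

theorem IsImage.isSharp {f : X ⟶ Y} {p : Pred Y} (h : IsImage f p) : IsSharp p := ⟨X, f, h⟩

theorem IsImage.comp_eq_zero_iff {f : X ⟶ Y} {p : Pred Y} (h : IsImage f p) (g : Y ⟶ Z) :
    f ≫ g = 0 ↔ PCM.Le (g ≫ truth Z) (compl p) := by
  rw [← comp_truth_eq_zero_iff, Category.assoc, ← compl_compl (g ≫ truth Z),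
    ← comp_eq_truth_iff, compl_compl, ← le_compl_comm]
  exact ⟨h.2 _, fun hp => (le_truth _ |> comp_le f).antisymm (h.1 ▸ comp_le f hp)⟩

theorem IsImage.of_le {f : X ⟶ Y} {p q : Pred Y} (hp : IsImage f p) (hq : PCM.Le p q) :
    f ≫ q = f ≫ truth Y :=
  (comp_le f (le_truth q)).antisymm (hp.1 ▸ comp_le f hq)

theorem isSharp_truth : IsSharp (truth X) := by
  refine ⟨X, 𝟙 X, rfl, fun q hq => ?_⟩
  rw [Category.id_comp, Category.id_comp] at hq
  rw [hq]
  exact PCM.Le.refl _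

end QuotientsComprehensions

/-! ### Floors, ceilings and `◇`-adjointness. -/

section Diamond

variable {C : Type u} [Category.{v} C] [HasFiniteCoproducts C] [Effectus C] [DiamondEffectus C]
variable {X Y Z K Q : C}

theorem compr_spec (p : Pred X) : IsComprehension p (compr p) :=
  (DiamondEffectus.exists_comprehension p).choose_spec.choose_spec

theorem im_spec (f : X ⟶ Y) : IsImage f (im f) := (DiamondEffectus.exists_image f).choose_spec

theorem isSharp_im (f : X ⟶ Y) : IsSharp (im f) := (im_spec f).isSharp

/-- Factor `π = π' ∘ ξ` with `ξ` a quotient for `(1 ∘ π)^⊥`. As `ξ` is epi, `π'` again satisfies the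
condition of the comprehension, so `π' = π ∘ k`. Then `k ∘ ξ = id` because `π` is mono, whence `1 ≤
1 ∘ ξ = 1 ∘ π`. -/
theorem IsComprehension.total {p : Pred X} {π : K ⟶ X} (h : IsComprehension p π) :
    π ≫ truth X = truth K := by
  obtain ⟨Q, ξ, hξ⟩ := DiamondEffectus.exists_quotient (compl (π ≫ truth X))
  have := hξ.epi
  have := h.mono
  have hξt := hξ.comp_truth
  rw [compl_compl] at hξt
  obtain ⟨π', hπ', -⟩ := hξ.2 π (by rw [compl_compl]; exact PCM.Le.refl _)
  obtain ⟨k, hk, -⟩ := h.2 π'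
    (by rw [← cancel_epi ξ, reassoc_of% hπ', reassoc_of% hπ', h.1])
  have h1 : ξ ≫ k = 𝟙 K := by
    rw [← cancel_mono π, Category.assoc, hk, hπ', Category.id_comp]
  refine eq_truth_of_truth_le ?_
  have := comp_le_truth ξ k
  rwa [h1, Category.id_comp, hξt] at this

theorem IsComprehension.comp_eq_truth {p : Pred X} {π : K ⟶ X} (h : IsComprehension p π) :
    π ≫ p = truth K := by
  rw [h.1, h.total]

theorem im_le_iff {f : X ⟶ Y} {q : Pred Y} : PCM.Le (im f) q ↔ f ≫ q = f ≫ truth Y :=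
  ⟨(im_spec f).of_le, (im_spec f).2 q⟩

theorem im_congr {X' : C} {f : X ⟶ Y} {g : X' ⟶ Y}
    (h : ∀ q : Pred Y, f ≫ q = f ≫ truth Y ↔ g ≫ q = g ≫ truth Y) : im f = im g :=
  PCM.Le.antisymm (im_le_iff.2 ((h _).2 (im_spec g).1)) (im_le_iff.2 ((h _).1 (im_spec f).1))

theorem im_comp_le (f : X ⟶ Y) (g : Y ⟶ Z) : PCM.Le (im (f ≫ g)) (im g) :=
  im_le_iff.2 (by rw [Category.assoc, (im_spec g).1, Category.assoc])

theorem im_epi_comp (f : X ⟶ Y) [Epi f] (g : Y ⟶ Z) : im (f ≫ g) = im g :=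
  im_congr fun q => by rw [Category.assoc, Category.assoc, cancel_epi]

theorem IsComprehension.im_eq_floor {p : Pred X} {π : K ⟶ X} (h : IsComprehension p π) :
    im π = floor p := by
  obtain ⟨e, _, rfl⟩ := (compr_spec p).exists_iso h
  exact im_epi_comp e _

theorem floor_le (p : Pred X) : PCM.Le (floor p) p := im_le_iff.2 (compr_spec p).1

theorem isSharp_floor (p : Pred X) : IsSharp (floor p) := isSharp_im _

theorem comp_floor_iff (f : X ⟶ Y) (p : Pred Y) :
    f ≫ floor p = f ≫ truth Y ↔ f ≫ p = f ≫ truth Y := by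
  constructor
  · intro h
    exact (comp_le f (le_truth p)).antisymm (h ▸ comp_le f (floor_le p))
  · intro h
    obtain ⟨g, rfl, -⟩ := (compr_spec p).2 f h
    rw [Category.assoc, Category.assoc, floor, (im_spec (compr p)).1]

theorem IsSharp.floor_eq {s : Pred X} (hs : IsSharp s) : floor s = s := by
  obtain ⟨W, f, hf⟩ := hs
  exact (floor_le s).antisymm (hf.2 _ ((comp_floor_iff f s).2 hf.1))

theorem IsComprehension.floor {p : Pred X} {π : K ⟶ X} (h : IsComprehension p π) :
    IsComprehension (floor p) π :=
  ⟨(comp_floor_iff π p).2 h.1, fun _ g hg => h.2 g ((comp_floor_iff g p).1 hg)⟩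

theorem IsComprehension.im {p : Pred X} {π : K ⟶ X} (h : IsComprehension p π) :
    IsComprehension (im π) π := by
  rw [h.im_eq_floor]
  exact h.floor

theorem IsComprehension.im_eq {s : Pred X} {π : K ⟶ X} (h : IsComprehension s π)
    (hs : IsSharp s) : EffectusTheory.im π = s := by
  rw [h.im_eq_floor, hs.floor_eq]

theorem IsComprehension.isIso_of_im_eq {p : Pred X} {π : K ⟶ X} (h : IsComprehension p π)
    (hi : EffectusTheory.im π = truth X) : IsIso π := by
  have h1 := h.im
  rw [hi] at h1
  obtain ⟨e, he, h2⟩ := isComprehension_id.exists_iso h1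
  rw [← h2, Category.comp_id]
  exact he

theorem IsSharp.compl {s : Pred X} (hs : IsSharp s) : IsSharp (compl s) :=
  DiamondEffectus.isSharp_compl s hs

theorem isSharp_ceil (p : Pred X) : IsSharp (ceil p) := (isSharp_floor _).compl

theorem le_ceil (p : Pred X) : PCM.Le p (ceil p) := by
  have := compl_le_compl (floor_le (EffectusTheory.compl p))
  rwa [compl_compl] at this

theorem IsSharp.ceil_eq {s : Pred X} (hs : IsSharp s) : ceil s = s := by
  rw [ceil, hs.compl.floor_eq, compl_compl]

theorem comp_ceil_eq_zero_iff (f : X ⟶ Y) (p : Pred Y) : f ≫ ceil p = 0 ↔ f ≫ p = 0 := by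
  rw [ceil, ← comp_eq_truth_iff, comp_floor_iff, comp_eq_truth_iff, compl_compl]

theorem ceil_congr {p q : Pred X} (h : ∀ {W : C} (g : W ⟶ X), g ≫ p = 0 ↔ g ≫ q = 0) :
    ceil p = ceil q := by
  have key : ∀ {a b : Pred X}, (∀ {W : C} (g : W ⟶ X), g ≫ a = 0 ↔ g ≫ b = 0) →
      PCM.Le (floor (EffectusTheory.compl a)) (floor (EffectusTheory.compl b)) := by
    intro a b hab
    refine im_le_iff.2 ((comp_floor_iff _ _).2 ?_)
    rw [comp_eq_truth_iff, compl_compl, ← hab]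
    have := (compr_spec (EffectusTheory.compl a)).1
    rwa [comp_eq_truth_iff, compl_compl] at this
  rw [ceil, ceil, (key h).antisymm (key fun g => (h g).symm)]

theorem ceil_comp_ceil (f : X ⟶ Y) (p : Pred Y) : ceil (f ≫ ceil p) = ceil (f ≫ p) :=
  ceil_congr fun g => by
    rw [← Category.assoc, comp_ceil_eq_zero_iff, Category.assoc]

/-- The image of a composite depends on the first map only through its image; this is functoriality
of `f ↦ f_◇`. -/
theorem im_compr_im_comp (f : X ⟶ Y) (g : Y ⟶ Z) : im (compr (im f) ≫ g) = im (f ≫ g) := by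
  obtain ⟨k, hk, -⟩ := (compr_spec (im f)).2 f (im_spec f).1
  refine PCM.Le.antisymm (im_le_iff.2 ?_) ?_
  · have h := (im_spec (f ≫ g)).1
    rw [comp_eq_truth_iff, Category.assoc, ← compl_compl (g ≫ _), ← comp_eq_truth_iff,
      ← im_le_iff] at h
    rw [comp_eq_truth_iff, Category.assoc, ← compl_compl (g ≫ _), ← comp_eq_truth_iff]
    refine (comp_le _ (le_truth _)).antisymm ?_
    have := comp_le (compr (im f)) h
    rwa [(compr_spec (im f)).1] at this
  · have := im_comp_le k (compr (im f) ≫ g)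
    rwa [reassoc_of% hk] at this

theorem DiamondAdjoint.comp_self {g : X ⟶ X} (h : DiamondAdjoint g g) :
    DiamondAdjoint (g ≫ g) (g ≫ g) := by
  intro s hs
  have h1 : diamondUp (g ≫ g) s = diamondUp g (diamondUp g s) := by
    rw [diamondUp, diamondUp, diamondUp, ceil_comp_ceil, Category.assoc]
  have h2 : diamondDown (g ≫ g) s = diamondDown g (diamondDown g s) := by
    rw [diamondDown, diamondDown, diamondDown, im_compr_im_comp, Category.assoc]
  rw [h1, h2, h (diamondUp g s) (isSharp_ceil _), h s hs]

theorem DiamondAdjoint.im_eq {f : X ⟶ X} (h : DiamondAdjoint f f) :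
    im f = ceil (f ≫ truth X) := by
  have h1 := h (truth X) isSharp_truth
  obtain ⟨e, he, h2⟩ := (isComprehension_id (X := X)).exists_iso (compr_spec (truth X))
  have h3 : im (compr (truth X) ≫ f) = im f := by
    rw [← h2, Category.comp_id, im_epi_comp]
  rw [← h3]
  exact h1.symm

/-- A predicate below both a sharp predicate and its orthocomplement vanishes. -/
theorem IsSharp.eq_zero_of_le_of_le_compl {s p : Pred X} (hs : IsSharp s) (h : PCM.Le p s)
    (h' : PCM.Le p (EffectusTheory.compl s)) : p = 0 := by
  have mono : ∀ {t : Pred X}, IsSharp t → PCM.Le p t → PCM.Le (ceil p) t := by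
    intro t ht hpt
    rw [ceil, ← compl_compl t]
    refine compl_le_compl ?_
    rw [← ht.compl.floor_eq]
    refine im_le_iff.2 ((comp_floor_iff _ _).2 ?_)
    exact (comp_le _ (le_truth _)).antisymm
      ((compr_spec (EffectusTheory.compl t)).1 ▸ comp_le _ (compl_le_compl hpt))
  -- `⌈p⌉` is below both `s` and `s^⊥`, hence below its own orthocomplement, so its comprehension is
  -- zero.
  have h1 : PCM.Le (ceil p) (EffectusTheory.compl (ceil p)) :=
    (mono hs h).trans (le_compl_comm.1 (mono hs.compl h'))
  have hc := compr_spec (ceil p)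
  have h2 := comp_le (compr (ceil p)) h1
  rw [hc.1, (comp_eq_truth_iff _ _).1 hc.1] at h2
  have h3 : compr (ceil p) = 0 := comp_truth_eq_zero_iff.1 (eq_zero_of_le_zero h2)
  have h4 : PCM.Le (ceil p) 0 := by
    rw [← (isSharp_ceil p).floor_eq]
    exact im_le_iff.2 (by rw [h3, zero_comp, zero_comp])
  exact eq_zero_of_le_zero ((le_ceil p).trans h4)

end Diamond

/-! ### Splitting of sharp assert maps; composition and sharpness. -/

section Andthen

variable {C : Type u} [Category.{v} C] [HasFiniteCoproducts C] [Effectus C] [AndthenEffectus C]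
variable {X Y Z K Q : C}

/-- The composite is pure. It is total, which makes its quotient part invertible, and its image is
`1`, which makes its comprehension part invertible. -/
theorem isIso_comprehension_comp_quotient {s : Pred X} (hs : IsSharp s) {π : K ⟶ X} {ξ : X ⟶ Q}
    (hπ : IsComprehension s π) (hξ : IsQuotient (compl s) ξ) : IsIso (π ≫ ξ) := by
  have := hξ.epi
  have hξt := hξ.comp_truth
  rw [compl_compl] at hξt
  obtain ⟨W, ξ', π', ⟨p, hp⟩, ⟨q, hq⟩, e⟩ :=
    AndthenEffectus.isPure_comprehension_comp_quotient π ξ ⟨_, hπ⟩ ⟨_, hξ⟩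
  have htot : (π ≫ ξ) ≫ truth Q = truth K := by rw [Category.assoc, hξt, hπ.comp_eq_truth]
  have hξ' : IsIso ξ' :=
    hp.isIso_of_total (by rw [← htot, e, Category.assoc, hq.total])
  have him : im (π ≫ ξ) = truth Q := by
    have h1 : (π ≫ ξ) ≫ compl (im (π ≫ ξ)) = 0 :=
      (comp_eq_truth_iff _ _).1 (im_spec (π ≫ ξ)).1
    -- Being below `1 ∘ ξ = s` and, since it vanishes on `π`, below `s^⊥`, this predicate is zero.
    have h2 : ξ ≫ compl (im (π ≫ ξ)) = 0 := by
      refine hs.eq_zero_of_le_of_le_compl ?_ ?_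
      · have := comp_le ξ (le_truth (compl (im (π ≫ ξ))))
        rwa [hξt] at this
      · rw [le_compl_comm, ← hπ.im_eq hs, im_le_iff, comp_eq_truth_iff, compl_compl,
          ← Category.assoc, h1]
    have h3 : compl (im (π ≫ ξ)) = 0 := by rw [← cancel_epi ξ, h2, comp_zero]
    rw [← compl_compl (im (π ≫ ξ)), h3, compl_zero]
  have hπ' : IsIso π' := hq.isIso_of_im_eq (by rw [← him, e, im_epi_comp])
  rw [e]
  infer_instance

theorem asrt_comp_truth (p : Pred X) : asrt p ≫ truth X = p :=
  (AndthenEffectus.existsUnique_asrt p).choose_spec.1.2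

theorem eq_asrt {p : Pred X} {f : X ⟶ X} (hf : DiamondPositive f) (h : f ≫ truth X = p) :
    f = asrt p :=
  (AndthenEffectus.existsUnique_asrt p).choose_spec.2 f ⟨hf, h⟩

theorem diamondAdjoint_asrt (p : Pred X) : DiamondAdjoint (asrt p) (asrt p) := by
  obtain ⟨-, g, hg, h⟩ := asrt_diamondPositive p
  rw [h]
  exact hg.comp_self

theorem im_asrt (p : Pred X) : im (asrt p) = ceil p := by
  rw [(diamondAdjoint_asrt p).im_eq, asrt_comp_truth]

/-- A quotient with sharp domain of definition splits, and the resulting idempotent is the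
assert map. -/
theorem IsQuotient.exists_section {s : Pred X} (hs : IsSharp s) {ξ : X ⟶ Q}
    (hξ : IsQuotient (compl s) ξ) :
    ∃ π : Q ⟶ X, IsComprehension s π ∧ π ≫ ξ = 𝟙 Q ∧ ξ ≫ π = asrt s := by
  obtain ⟨W, ξ', π', ⟨p, hp⟩, ⟨q, hq⟩, e⟩ := (asrt_diamondPositive s).1
  -- The domain predicate and the image of `asrt_s` are both `s`; they identify the two factors as a
  -- quotient for `s^⊥` and a comprehension for `s`.
  have hps : compl p = s := by
    rw [← hp.comp_truth, ← hq.total, ← Category.assoc, ← e, asrt_comp_truth]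
  have hp' : IsQuotient (compl s) ξ' := by rwa [← hps, compl_compl]
  have hπ' : IsComprehension s π' := by
    have := hp.epi
    have h := hq.im
    rwa [← im_epi_comp ξ', ← e, im_asrt, hs.ceil_eq] at h
  obtain ⟨θ, _, rfl⟩ := hξ.exists_iso hp'
  have hπ : IsComprehension s (θ ≫ π') := hπ'.isIso_comp θ
  rw [Category.assoc] at e
  refine ⟨θ ≫ π', hπ, ?_, e.symm⟩
  have := isIso_comprehension_comp_quotient hs hπ hξ
  -- The middle part `ξ ∘ π` of the square is invertible and can be absorbed into the comprehension,
  -- so the square is pure.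
  have hpos : DiamondPositive (asrt s ≫ asrt s) := by
    refine ⟨?_, asrt s, diamondAdjoint_asrt s, rfl⟩
    have h := isPure_of_eq hξ (hπ.isIso_comp ((θ ≫ π') ≫ ξ))
    rw [e]
    simpa only [Category.assoc] using h
  -- Uniqueness of assert maps, as the square has domain predicate `s` too. Cancelling the epi `ξ`
  -- and the mono then yields the splitting.
  have hidem : asrt s ≫ asrt s = asrt s := by
    refine eq_asrt hpos ?_
    have h := (im_spec (asrt s)).1
    rw [im_asrt, hs.ceil_eq, asrt_comp_truth] at h
    rw [Category.assoc, asrt_comp_truth, h]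
  have := hξ.epi
  have := hπ.mono
  rw [← cancel_epi ξ, ← cancel_mono (θ ≫ π'), Category.comp_id]
  rw [e] at hidem
  simpa only [Category.assoc] using hidem

/-- A comprehension for a sharp predicate splits, and the resulting idempotent is the
assert map. -/
theorem IsComprehension.exists_retraction {s : Pred X} (hs : IsSharp s) {π : K ⟶ X}
    (hπ : IsComprehension s π) :
    ∃ ξ : X ⟶ K, IsQuotient (compl s) ξ ∧ π ≫ ξ = 𝟙 K ∧ ξ ≫ π = asrt s := by
  obtain ⟨Q, ξ, hξ⟩ := DiamondEffectus.exists_quotient (compl s)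
  obtain ⟨π', hπ', h1, h2⟩ := hξ.exists_section hs
  obtain ⟨e, _, rfl⟩ := hπ.exists_iso hπ'
  refine ⟨ξ ≫ e, hξ.comp_isIso e, ?_, by rw [Category.assoc, h2]⟩
  rw [← cancel_epi e, ← Category.assoc, ← Category.assoc, h1, Category.id_comp,
    Category.comp_id]

theorem IsComprehension.comp {p : Pred Y} {q : Pred Z} {π : X ⟶ Y} {ρ : Y ⟶ Z}
    (hπ : IsComprehension p π) (hρ : IsComprehension q ρ) :
    IsComprehension (EffectusTheory.im (π ≫ ρ)) (π ≫ ρ) := by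
  have := hπ.mono
  have := hρ.mono
  refine ⟨(im_spec _).1, fun W g hg => ?_⟩
  have hg1 : g ≫ q = g ≫ truth Z := by
    have h2 := comp_le g (im_le_iff.2 (show (π ≫ ρ) ≫ q = (π ≫ ρ) ≫ truth Z by
      rw [Category.assoc, hρ.1, Category.assoc]))
    rw [hg] at h2
    exact (comp_le g (le_truth q)).antisymm h2
  obtain ⟨g', rfl, -⟩ := hρ.2 g hg1
  obtain ⟨ζ, -, h1, -⟩ := hρ.im.exists_retraction (isSharp_im ρ)
  -- The retraction `ζ` of `ρ` extends `p` to the predicate `p ∘ ζ` on `Z`, which can be compared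
  -- with the image and restricted back along `ρ`.
  have h2 : PCM.Le (EffectusTheory.im (π ≫ ρ)) (ζ ≫ p) := by
    rw [im_le_iff, Category.assoc, ← Category.assoc ρ, h1, Category.id_comp, hπ.1,
      Category.assoc, hρ.total]
  have h3 := comp_le (g' ≫ ρ) h2
  rw [hg, Category.assoc, hρ.total, Category.assoc, ← Category.assoc ρ, h1,
    Category.id_comp] at h3
  obtain ⟨k, rfl, -⟩ := hπ.2 g' ((comp_le g' (le_truth p)).antisymm h3)
  refine ⟨k, (Category.assoc _ _ _).symm, fun l hl => ?_⟩
  rw [← cancel_mono (π ≫ ρ), hl, Category.assoc]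

/-- Since `t ≤ s`, the map `asrt_s` fixes `π_t`, so `(asrt_s)_◇(t) = t`. Self-adjointness turns this
into `⌈t ∘ asrt_s⌉ = t`. -/
theorem asrt_comp_le {s t : Pred X} (hs : IsSharp s) (ht : IsSharp t) (h : PCM.Le t s) :
    PCM.Le (asrt s ≫ t) t := by
  obtain ⟨ξ, -, h1, h2⟩ := (compr_spec s).exists_retraction hs
  obtain ⟨k, hk, -⟩ := (compr_spec s).2 (compr t)
    ((comp_le _ (le_truth _)).antisymm ((compr_spec t).1 ▸ comp_le _ h))
  have h3 : compr t ≫ asrt s = compr t := by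
    rw [← hk, ← h2, Category.assoc, reassoc_of% h1]
  have h4 := diamondAdjoint_asrt s t ht
  rw [diamondUp, diamondDown, h3] at h4
  have h5 := le_ceil (asrt s ≫ t)
  rwa [h4, (compr_spec t).im_eq ht] at h5

/-- With `π` the section of `ξ`, the predicate `t ∘ ξ` is the image `v` of `π ∘ π_t`. The nontrivial
inequality is `t ∘ ξ ≤ v ∘ π ∘ ξ = v ∘ asrt_s ≤ v`. -/
theorem IsQuotient.isSharp_comp {s : Pred X} (hs : IsSharp s) {ξ : X ⟶ Q}
    (hξ : IsQuotient (EffectusTheory.compl s) ξ) {t : Pred Q} (ht : IsSharp t) :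
    IsSharp (ξ ≫ t) := by
  obtain ⟨π, hπ, h1, h2⟩ := hξ.exists_section hs
  set v := im (compr t ≫ π)
  have hvs : PCM.Le v s := by
    have := im_comp_le (compr t) π
    rwa [hπ.im_eq hs] at this
  have hle : PCM.Le v (ξ ≫ t) := by
    rw [im_le_iff, Category.assoc, ← Category.assoc π, h1, Category.id_comp, (compr_spec t).1,
      Category.assoc, hπ.total]
  have htv : PCM.Le t (π ≫ v) := by
    rw [← (compr_spec t).im_eq ht, im_le_iff, ← Category.assoc, (im_spec (compr t ≫ π)).1,
      Category.assoc, hπ.total]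
  have h3 := comp_le ξ htv
  rw [← Category.assoc, h2] at h3
  rw [← hle.antisymm (h3.trans (asrt_comp_le hs (isSharp_im _) hvs))]
  exact isSharp_im _

theorem IsQuotient.comp {s : Pred X} {t : Pred Y} (hs : IsSharp s) {ξ : X ⟶ Y} {ζ : Y ⟶ Z}
    (hξ : IsQuotient (EffectusTheory.compl s) ξ) (hζ : IsQuotient (EffectusTheory.compl t) ζ) :
    IsQuotient (EffectusTheory.compl (ξ ≫ t)) (ξ ≫ ζ) := by
  have := hξ.epi
  have := hζ.epi
  have hξt := hξ.comp_truth
  have hζt := hζ.comp_truth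
  rw [compl_compl] at hξt hζt
  refine ⟨by rw [Category.assoc, hζt, compl_compl]; exact PCM.Le.refl _, fun W f hf => ?_⟩
  rw [compl_compl] at hf
  obtain ⟨f', rfl, -⟩ := hξ.2 f (by
    have := comp_le ξ (le_truth t)
    rw [hξt] at this
    rw [compl_compl]
    exact hf.trans this)
  obtain ⟨π, -, h1, -⟩ := hξ.exists_section hs
  -- Restricting `1 ∘ f' ∘ ξ ≤ t ∘ ξ` along the section gives `1 ∘ f' ≤ t`.
  have h2 := comp_le π hf
  rw [Category.assoc, reassoc_of% h1, reassoc_of% h1] at h2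
  obtain ⟨k, rfl, -⟩ := hζ.2 f' (by rwa [compl_compl])
  refine ⟨k, Category.assoc _ _ _, fun l hl => ?_⟩
  rw [← cancel_epi (ξ ≫ ζ), hl, Category.assoc]

/-- Because `t ≤ s`, `π_t` factors as `π ∘ k`, and `t ∘ π` turns out to be `im k`; the retraction of
`π` gives the inequality `t ∘ π ≤ im k`. -/
theorem IsComprehension.isSharp_comp {s t : Pred X} (hs : IsSharp s) (ht : IsSharp t)
    (h : PCM.Le t s) {π : K ⟶ X} (hπ : IsComprehension s π) : IsSharp (π ≫ t) := by
  obtain ⟨ζ, hζ, h1, -⟩ := hπ.exists_retraction hs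
  obtain ⟨k, hk, -⟩ := hπ.2 (compr t)
    ((comp_le _ (le_truth _)).antisymm ((compr_spec t).1 ▸ comp_le _ h))
  have hkt : k ≫ truth K = compr t ≫ truth X := by
    rw [← hk, Category.assoc, hπ.total]
  have h2 : PCM.Le (EffectusTheory.im k) (π ≫ t) := by
    rw [im_le_iff, ← Category.assoc, hk, (compr_spec t).1, hkt]
  have h3 : PCM.Le t (ζ ≫ EffectusTheory.im k) := by
    have h4 : compr t ≫ ζ ≫ EffectusTheory.im k = compr t ≫ truth X := by
      rw [← hkt, ← (im_spec k).1, ← hk, Category.assoc, reassoc_of% h1]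
    rwa [← im_le_iff, (compr_spec t).im_eq ht] at h4
  have h4 := comp_le π h3
  rw [← Category.assoc, h1, Category.id_comp] at h4
  rw [← h2.antisymm h4]
  exact isSharp_im k

end Andthen

/-! ### Kernels, cokernels and exact maps. -/

section KernelsCokernels

variable {C : Type u} [Category.{v} C] [HasFiniteCoproducts C] [Effectus C]
variable {X Y Z : C}

theorem comp_compl_comp_truth_iff (f : X ⟶ Y) (g : Y ⟶ Z) :
    f ≫ compl (g ≫ truth Z) = f ≫ truth Y ↔ f ≫ g = 0 := by
  rw [comp_eq_truth_iff, compl_compl, ← Category.assoc, comp_truth_eq_zero_iff]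

theorem nonempty_isLimit_kernelFork_iff {m : X ⟶ Y} {g : Y ⟶ Z} (w : m ≫ g = 0) :
    Nonempty (IsLimit (KernelFork.ofι m w)) ↔ IsComprehension (compl (g ≫ truth Z)) m := by
  constructor
  · rintro ⟨h⟩
    refine ⟨(comp_compl_comp_truth_iff m g).2 w, fun W k hk => ?_⟩
    obtain ⟨l, hl⟩ := KernelFork.IsLimit.lift' h k ((comp_compl_comp_truth_iff k g).1 hk)
    exact ⟨l, hl, fun l' hl' => Fork.IsLimit.hom_ext h (hl'.trans hl.symm)⟩
  · intro h
    have := h.mono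
    exact ⟨KernelFork.IsLimit.ofι' m w fun k hk =>
      ⟨(h.2 k ((comp_compl_comp_truth_iff k g).2 hk)).choose,
        (h.2 k ((comp_compl_comp_truth_iff k g).2 hk)).choose_spec.1⟩⟩

theorem nonempty_isColimit_cokernelCofork_iff {f : X ⟶ Y} {q : Y ⟶ Z} (w : f ≫ q = 0)
    {s : Pred Y} (hs : IsImage f s) :
    Nonempty (IsColimit (CokernelCofork.ofπ q w)) ↔ IsQuotient s q := by
  constructor
  · rintro ⟨h⟩
    refine ⟨(hs.comp_eq_zero_iff q).1 w, fun W k hk => ?_⟩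
    obtain ⟨l, hl⟩ := CokernelCofork.IsColimit.desc' h k ((hs.comp_eq_zero_iff k).2 hk)
    exact ⟨l, hl, fun l' hl' => Cofork.IsColimit.hom_ext h (hl'.trans hl.symm)⟩
  · intro h
    have := h.epi
    exact ⟨CokernelCofork.IsColimit.ofπ' q w fun k hk =>
      ⟨(h.2 k ((hs.comp_eq_zero_iff k).1 hk)).choose,
        (h.2 k ((hs.comp_eq_zero_iff k).1 hk)).choose_spec.1⟩⟩

theorem isKernelMap_iff {m : X ⟶ Y} :
    IsKernelMap m ↔ ∃ p : Pred Y, IsComprehension p m := by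
  constructor
  · rintro ⟨h⟩
    exact ⟨_, (nonempty_isLimit_kernelFork_iff h.w).1 ⟨h.isLimit⟩⟩
  · rintro ⟨p, h⟩
    -- A comprehension for `p` is the kernel of the predicate `p^⊥`, viewed as a map to `I`.
    have w : m ≫ compl p = 0 := (comp_eq_truth_iff m p).1 h.1
    obtain ⟨l⟩ := (nonempty_isLimit_kernelFork_iff w).2
      (by rwa [pred_comp_truth, compl_compl])
    exact ⟨⟨_, _, w, l⟩⟩

theorem isComprehension_kernel_ι (f : X ⟶ Y) [HasKernel f] :
    IsComprehension (compl (f ≫ truth Y)) (kernel.ι f) :=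
  (nonempty_isLimit_kernelFork_iff (kernel.condition f)).1 ⟨kernelIsKernel f⟩

variable [DiamondEffectus C]

theorem isCokernelMap_iff {q : X ⟶ Y} :
    IsCokernelMap q ↔ ∃ s : Pred X, IsSharp s ∧ IsQuotient s q := by
  constructor
  · rintro ⟨h⟩
    exact ⟨_, isSharp_im h.g,
      (nonempty_isColimit_cokernelCofork_iff h.w (im_spec h.g)).1 ⟨h.isColimit⟩⟩
  · rintro ⟨s, ⟨W, f, hf⟩, h⟩
    have w : f ≫ q = 0 := (hf.comp_eq_zero_iff q).2 h.1
    obtain ⟨l⟩ := (nonempty_isColimit_cokernelCofork_iff w hf).2 h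
    exact ⟨⟨_, f, w, l⟩⟩

theorem pointedSemiexact : PointedSemiexact C where
  hasZeroObject := ⟨⊥_ C, (IsZero.iff_id_eq_zero _).2 (initial.hom_ext _ _)⟩
  hasKernels := ⟨fun {X Y} f => by
    obtain ⟨K, π, h⟩ := DiamondEffectus.exists_comprehension (compl (f ≫ truth Y))
    obtain ⟨l⟩ := (nonempty_isLimit_kernelFork_iff ((comp_compl_comp_truth_iff π f).1 h.1)).2 h
    exact ⟨⟨⟨_, l⟩⟩⟩⟩
  hasCokernels := ⟨fun {X Y} f => by
    obtain ⟨Q, ξ, h⟩ := DiamondEffectus.exists_quotient (im f)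
    obtain ⟨l⟩ := (nonempty_isColimit_cokernelCofork_iff
      (((im_spec f).comp_eq_zero_iff ξ).2 h.1) (im_spec f)).2 h
    exact ⟨⟨⟨_, l⟩⟩⟩⟩

theorem isQuotient_cokernel_π (f : X ⟶ Y) [HasCokernel f] :
    IsQuotient (im f) (cokernel.π f) :=
  (nonempty_isColimit_cokernelCofork_iff (cokernel.condition f) (im_spec f)).1
    ⟨cokernelIsCokernel f⟩

variable [PointedSemiexact C]

theorem isQuotient_coimage_π (f : X ⟶ Y) :
    IsQuotient (floor (compl (f ≫ truth Y))) (Abelian.coimage.π f) := by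
  rw [← (isComprehension_kernel_ι f).im_eq_floor]
  exact isQuotient_cokernel_π _

theorem isComprehension_image_ι (f : X ⟶ Y) : IsComprehension (im f) (Abelian.image.ι f) := by
  have h := isComprehension_kernel_ι (cokernel.π f)
  rwa [(isQuotient_cokernel_π f).comp_truth, compl_compl] at h

theorem isExactMap_iff {f : X ⟶ Y} : IsExactMap f ↔ IsPristine f := by
  have hq := isQuotient_coimage_π f
  have hc := isComprehension_image_ι f
  have hf := Abelian.coimage_image_factorisation f
  have := hq.epi
  have := hc.mono
  constructor
  · intro h
    have : IsIso (Abelian.coimageImageComparison f) := h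
    have hc' := hc.isIso_comp (Abelian.coimageImageComparison f)
    refine ⟨?_, ?_⟩
    · rw [← hf]
      exact isPure_of_eq hq hc'
    · have h1 : f ≫ truth Y = compl (floor (compl (f ≫ truth Y))) := by
        rw [← hq.comp_truth, ← hc'.total, ← Category.assoc, hf]
      rw [h1]
      exact (isSharp_floor _).compl
  · rintro ⟨⟨W, ξ, π, ⟨p, hξ⟩, ⟨q, hπ⟩, e⟩, hs⟩
    have h1 : compl (f ≫ truth Y) = p := by
      rw [e, Category.assoc, hπ.total, hξ.comp_truth, compl_compl]
    -- Sharpness removes the floor, so the coimage projection and `ξ` are quotients for the same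
    -- predicate.
    rw [hs.compl.floor_eq, h1] at hq
    have := hξ.epi
    have hπ' := hπ.im
    rw [← im_epi_comp ξ, ← e] at hπ'
    obtain ⟨a, _, ha⟩ := hq.exists_iso hξ
    obtain ⟨b, _, hb⟩ := hc.exists_iso hπ'
    have h2 : Abelian.coimageImageComparison f = a ≫ b := by
      rw [← cancel_epi (Abelian.coimage.π f), ← cancel_mono (Abelian.image.ι f),
        Category.assoc, hf]
      simp only [Category.assoc, hb]
      rw [← Category.assoc, ha, ← e]
    rw [IsExactMap, h2]
    infer_instance

end KernelsCokernels

/-! ### The homological axioms. -/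

theorem pointedHomological (C : Type u) [Category.{v} C] [HasFiniteCoproducts C] [Effectus C]
    [AndthenEffectus C] : PointedHomological C :=
  { pointedSemiexact (C := C) with
    isKernelMap_comp := by
      intro X Y Z m n hm hn
      obtain ⟨p, hp⟩ := isKernelMap_iff.1 hm
      obtain ⟨q, hq⟩ := isKernelMap_iff.1 hn
      exact isKernelMap_iff.2 ⟨_, hp.comp hq⟩
    isCokernelMap_comp := by
      intro X Y Z p q hp hq
      obtain ⟨s, hs, hp⟩ := isCokernelMap_iff.1 hp
      obtain ⟨t, ht, hq⟩ := isCokernelMap_iff.1 hq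
      rw [← compl_compl s] at hp
      rw [← compl_compl t] at hq
      exact isCokernelMap_iff.2
        ⟨_, (hp.isSharp_comp hs.compl ht.compl).compl, hp.comp hs.compl hq⟩
    homology := by
      intro M A Q m q hm hq ⟨f, hf⟩
      have := pointedSemiexact (C := C)
      obtain ⟨p, hm⟩ := isKernelMap_iff.1 hm
      obtain ⟨t, ht, hq⟩ := isCokernelMap_iff.1 hq
      have hk := isComprehension_kernel_ι q
      rw [hq.comp_truth, compl_compl] at hk
      -- `ker q` is a comprehension for the sharp `t`, so `ker q ≤ m` becomes an inequality of
      -- images.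
      have htm : PCM.Le t (im m) := by
        have h := im_comp_le f m
        rwa [hf, hk.im_eq ht] at h
      refine isExactMap_iff.2
        ⟨AndthenEffectus.isPure_comprehension_comp_quotient m q ⟨_, hm⟩ ⟨_, hq⟩, ?_⟩
      -- As `m` is total, the domain predicate of the composite is `(t ∘ m)^⊥`.
      rw [Category.assoc, hq.comp_truth, comp_compl_of_total hm.total]
      exact (hm.im.isSharp_comp (isSharp_im m) ht htm).compl }

end EffectusTheory

theorem mainTheorem3 (C : Type u) [Category.{v} C] [HasFiniteCoproducts C] [Effectus C]
    [DaggerEffectus C] :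
    ∃ _ : PointedHomological C,
      (∀ {X Y : C} (f : X ⟶ Y), IsKernelMap f ↔ ∃ p : Pred Y, IsComprehension p f) ∧
      (∀ {X Y : C} (f : X ⟶ Y),
        IsCokernelMap f ↔ ∃ s : Pred X, IsSharp s ∧ IsQuotient s f) ∧
      (∀ {X Y : C} (f : X ⟶ Y), IsExactMap f ↔ IsPristine f) := by
  have h := pointedHomological C
  exact ⟨h, fun _ => isKernelMap_iff, fun _ => isCokernelMap_iff, fun _ => isExactMap_iff⟩
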